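/- Let $\mathbb{K}$ be an algebraically closed field and let $A$ be a finite dimensional $\mathbb{K}$-algebra which is self-injective, i.e. the left $A$-module $A$ is injective. Suppose that $A$ fulfils the Tachikawa conjecture: every finitely generated left $A$-module $M$ with $\mathrm{Ext}_A^i(M,M)=0$ for all $i>0$ is projective. Let $f\colon A\to B$ be a homological ring epimorphism, i.e. an epimorphism in the category of unital rings with $\mathrm{Tor}_i^A(B,B)=0$ for all $i>0$, and suppose that $f$ is finite dimensional, i.e. $B$ is finite dimensional over $\mathbb{K}$ via $\mathbb{K}\to A\to B$. Then: 1. $f$ is a universal localisation: there is a set $\Sigma$ of maps between finitely generated projective left $A$-modules such that $B\otimes_A\sigma$ is an isomorphism for all $\sigma\in\Sigma$, and every ring homomorphism $g\colon A\to C$ such that $C\otimes_A\sigma$ is an isomorphism for all $\sigma\in\Sigma$ factors uniquely as $g=hf$ with a ring homomorphism $h\colon B\to C$; 2. $B$ is projective as a left $A$-module via $f$; 3. $B$ is self-injective, i.e. the left $B$-module $B$ is injective. -/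

import Mathlib

open CategoryTheory
open scoped TensorProduct

universe u v w

noncomputable section

section BalancedTensor

variable (A : Type u) [Ring A]

/-- For a right `A`-module `N` (a left module over the opposite ring) and a left `A`-module `M`,
the subgroup of `N ⊗_ℤ M` generated by all `n a ⊗ m - n ⊗ a m`. -/
def balancedSubgroup (N : Type v) [AddCommGroup N] [Module Aᵐᵒᵖ N]
    (M : Type w) [AddCommGroup M] [Module A M] : AddSubgroup (N ⊗[ℤ] M) :=
  AddSubgroup.closure
    {x | ∃ (n : N) (a : A) (m : M), x = (MulOpposite.op a • n) ⊗ₜ[ℤ] m - n ⊗ₜ[ℤ] (a • m)}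

/-- The tensor product `N ⊗_A M` over a not necessarily commutative ring `A`, as an abelian
group. -/
abbrev BalancedTensor (N : Type v) [AddCommGroup N] [Module Aᵐᵒᵖ N]
    (M : Type w) [AddCommGroup M] [Module A M] : Type (max v w) :=
  (N ⊗[ℤ] M) ⧸ balancedSubgroup A N M

variable {A}

/-- The map `N ⊗_A φ`, sending `n ⊗ m` to `n ⊗ φ m`. -/
def BalancedTensor.map (N : Type v) [AddCommGroup N] [Module Aᵐᵒᵖ N]
    {M M' : Type w} [AddCommGroup M] [Module A M] [AddCommGroup M'] [Module A M']
    (φ : M →ₗ[A] M') : BalancedTensor A N M →+ BalancedTensor A N M' :=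
  QuotientAddGroup.map _ _ (LinearMap.lTensor N (φ.restrictScalars ℤ)).toAddMonoidHom (by
    rw [balancedSubgroup, AddSubgroup.closure_le]
    rintro _ ⟨n, a, m, rfl⟩
    refine AddSubgroup.subset_closure ⟨n, a, φ m, ?_⟩
    simp)

lemma BalancedTensor.map_mk (N : Type v) [AddCommGroup N] [Module Aᵐᵒᵖ N]
    {M M' : Type w} [AddCommGroup M] [Module A M] [AddCommGroup M'] [Module A M']
    (φ : M →ₗ[A] M') (x : N ⊗[ℤ] M) :
    BalancedTensor.map N φ (QuotientAddGroup.mk x) =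
      QuotientAddGroup.mk (LinearMap.lTensor N (φ.restrictScalars ℤ) x) := rfl

/-- The functor `N ⊗_A -` from left `A`-modules to abelian groups. -/
def balancedTensorFunctor (N : ModuleCat.{u} Aᵐᵒᵖ) : ModuleCat.{u} A ⥤ AddCommGrpCat.{u} where
  obj M := AddCommGrpCat.of (BalancedTensor A N M)
  map φ := AddCommGrpCat.ofHom (BalancedTensor.map N φ.hom)
  map_id M := by
    ext x
    change BalancedTensor.map N _ (QuotientAddGroup.mk x) = QuotientAddGroup.mk x
    rw [BalancedTensor.map_mk]
    exact congrArg _ (LinearMap.lTensor_id_apply N M x)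
  map_comp φ ψ := by
    ext x
    change BalancedTensor.map N _ (QuotientAddGroup.mk x) =
      BalancedTensor.map N _ (BalancedTensor.map N _ (QuotientAddGroup.mk x))
    rw [BalancedTensor.map_mk, BalancedTensor.map_mk, BalancedTensor.map_mk]
    exact congrArg _
      (LinearMap.lTensor_comp_apply N (ψ.hom.restrictScalars ℤ) (φ.hom.restrictScalars ℤ) x)

instance balancedTensorFunctor_additive (N : ModuleCat.{u} Aᵐᵒᵖ) :
    (balancedTensorFunctor N).Additive where
  map_add {M M' φ ψ} := by
    ext x
    obtain ⟨x, rfl⟩ := QuotientAddGroup.mk_surjective x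
    change BalancedTensor.map N _ (QuotientAddGroup.mk x) =
      BalancedTensor.map N _ (QuotientAddGroup.mk x) +
        BalancedTensor.map N _ (QuotientAddGroup.mk x)
    rw [BalancedTensor.map_mk, BalancedTensor.map_mk, BalancedTensor.map_mk,
      ← QuotientAddGroup.mk_add]
    refine congrArg _ ?_
    rw [← LinearMap.add_apply, ← LinearMap.lTensor_add]
    rfl

/-- `Tor_n^A(N, M)` for a right `A`-module `N` and a left `A`-module `M`: the `n`-th left derived
functor of `N ⊗_A -`, evaluated at `M`. -/
def balancedTor (n : ℕ) (N : ModuleCat.{u} Aᵐᵒᵖ) (M : ModuleCat.{u} A) : AddCommGrpCat.{u} :=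
  ((balancedTensorFunctor N).leftDerived n).obj M

end BalancedTensor

section RingHoms

variable {A : Type u} [Ring A]

/-- `B` as a left `A`-module along `f : A → B`. -/
abbrev leftModuleAlong {B : Type v} [Ring B] (f : A →+* B) : ModuleCat.{v} A :=
  (ModuleCat.restrictScalars f).obj (ModuleCat.of B B)

/-- `B` as a right `A`-module along `f : A → B`, with `b · a = b * f a`. -/
abbrev rightModuleAlong {B : Type v} [Ring B] (f : A →+* B) : ModuleCat.{v} Aᵐᵒᵖ :=
  (ModuleCat.restrictScalars (RingHom.op f)).obj (ModuleCat.of Bᵐᵒᵖ B)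

/-- A homological ring epimorphism: an epimorphism `f : A → B` in the category of (unital) rings
with `Tor_i^A(B, B) = 0` for all `i > 0`. -/
structure IsHomologicalRingEpi {B : Type u} [Ring B] (f : A →+* B) : Prop where
  epi : Epi (RingCat.ofHom f)
  tor_eq_zero : ∀ i : ℕ, 0 < i →
    Limits.IsZero (balancedTor i (rightModuleAlong f) (leftModuleAlong f))

/-- `f : A → B` is finite dimensional: `B` is a finite dimensional vector space over `𝕜` through
`𝕜 → A → B`. -/
def IsFiniteDimensionalHom (𝕜 : Type w) [Field 𝕜] [Algebra 𝕜 A] {B : Type v} [Ring B]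
    (f : A →+* B) : Prop :=
  Module.Finite 𝕜 ((ModuleCat.restrictScalars (algebraMap 𝕜 A)).obj (leftModuleAlong f))

/-- `B ⊗_A σ` is an isomorphism. -/
def InvertsMap {B : Type v} [Ring B] (f : A →+* B) (σ : Arrow (ModuleCat.{u} A)) : Prop :=
  Function.Bijective (BalancedTensor.map (rightModuleAlong f) σ.hom.hom)

/-- `f : A → B` is the universal localisation of `A` at the family `σ` of module maps: `B ⊗_A σ i`
is an isomorphism for all `i`, and `f` is universal with this property. The universe parameter `v`
lets the test rings `C` live in any universe above that of `A`. -/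
structure IsUniversalLocalisationAt {B : Type u} [Ring B] (f : A →+* B) {ι : Type u}
    (σ : ι → Arrow (ModuleCat.{u} A)) : Prop where
  inverts : ∀ i, InvertsMap f (σ i)
  existsUnique_factor : ∀ (C : Type (max u v)) [Ring C] (g : A →+* C),
    (∀ i, InvertsMap g (σ i)) → ∃! h : B →+* C, h.comp f = g

/-- `f : A → B` is a universal localisation: it is the universal localisation of `A` at some set
of maps between finitely generated projective (left) `A`-modules. -/
def IsUniversalLocalisation {B : Type u} [Ring B] (f : A →+* B) : Prop :=
  ∃ (ι : Type u) (σ : ι → Arrow (ModuleCat.{u} A)),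
    (∀ i, Module.Finite A (σ i).left ∧ Module.Projective A (σ i).left ∧
      Module.Finite A (σ i).right ∧ Module.Projective A (σ i).right) ∧
    IsUniversalLocalisationAt.{u, v} f σ

end RingHoms

/-- `A` is (left) self-injective: the free left `A`-module of rank one is injective. -/
def IsSelfInjectiveRing (A : Type u) [Ring A] : Prop :=
  Module.Injective A A

/-- The conclusion of the Tachikawa conjecture for `A`: every finitely generated `A`-module `M`
with `Ext_A^i(M, M) = 0` for all `i > 0` is projective. -/
def SatisfiesTachikawa (A : Type u) [Ring A] : Prop :=
  ∀ M : ModuleCat.{u} A, Module.Finite A M →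
    (∀ i : ℕ, 0 < i → Subsingleton (Abelian.Ext M M i)) → Module.Projective A M

end

/-! Restriction of scalars along a ring epimorphism is full (`map_smul_of_epi`). Let `P` be an
`A`-projective resolution of `B`. Vanishing of Tor, together with `B ⊗_A B = B`, makes `B ⊗_A P`
exact over the projective `B`-module `B`, hence split. So `Hom_B(B ⊗_A P, B) = Hom_A(P, B)` is exact
in positive degrees, that is, `Ext_A^i(B, B) = 0` for `i > 0`
(`IsHomologicalRingEpi.subsingleton_ext`), and the Tachikawa property makes `B` projective over `A`.
Then `f`, seen as a map `A → B` of finitely generated projective `A`-modules, is itself the map to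
invert (`isUniversalLocalisation_of_epi`). Over the self-injective ring `A` the module `B` is also
injective, and fullness transfers this to `B`-modules (`isSelfInjectiveRing_of_epi`). -/

noncomputable section

/-! ### Fullness of restriction along a ring epimorphism -/

section Epi

variable {A B : Type u} [Ring A] [Ring B] (f : A →+* B)
  {X Y : Type u} [AddCommGroup X] [Module B X] [AddCommGroup Y] [Module B Y]

/-- The action of `B` on `X × Y`, conjugated by the unipotent automorphism attached to an additive
map `X → Y`. -/
def shearedAction (B : Type u) [Ring B]
    {X Y : Type u} [AddCommGroup X] [Module B X] [AddCommGroup Y] [Module B Y] (φ : X →+ Y) :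
    B →+* AddMonoid.End (X × Y) where
  toFun b := AddMonoidHom.mk' (fun p => (b • p.1, b • p.2 + (φ (b • p.1) - b • φ p.1))) (by
    intro p q
    ext
    · simp
    · simp only [Prod.fst_add, Prod.snd_add, smul_add, map_add]
      abel)
  map_one' := by
    refine AddMonoidHom.ext fun p => Prod.ext (one_smul B p.1) ?_
    change (1 : B) • p.2 + (φ ((1 : B) • p.1) - (1 : B) • φ p.1) = p.2
    simp
  map_zero' := by
    refine AddMonoidHom.ext fun p => Prod.ext (zero_smul B p.1) ?_
    change (0 : B) • p.2 + (φ ((0 : B) • p.1) - (0 : B) • φ p.1) = 0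
    simp
  map_mul' a b := by
    refine AddMonoidHom.ext fun p => Prod.ext (mul_smul a b p.1) ?_
    change (a * b) • p.2 + (φ ((a * b) • p.1) - (a * b) • φ p.1) =
      a • (b • p.2 + (φ (b • p.1) - b • φ p.1)) + (φ (a • b • p.1) - a • φ (b • p.1))
    simp only [mul_smul, smul_add, smul_sub]
    abel
  map_add' a b := by
    refine AddMonoidHom.ext fun p => Prod.ext (add_smul a b p.1) ?_
    change (a + b) • p.2 + (φ ((a + b) • p.1) - (a + b) • φ p.1) =
      a • p.2 + (φ (a • p.1) - a • φ p.1) + (b • p.2 + (φ (b • p.1) - b • φ p.1))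
    simp only [add_smul, map_add]
    abel

lemma shearedAction_apply (φ : X →+ Y) (b : B) (p : X × Y) :
    (shearedAction B φ b : AddMonoid.End (X × Y)) p =
      (b • p.1, b • p.2 + (φ (b • p.1) - b • φ p.1)) := rfl

/-- Along a ring epimorphism, restriction of scalars is full. -/
lemma map_smul_of_epi (hf : Epi (RingCat.ofHom f)) (φ : X →+ Y)
    (hφ : ∀ a x, φ (f a • x) = f a • φ x) (b : B) (x : X) : φ (b • x) = b • φ x := by
  -- The shear term `φ (b x) - b φ x` vanishes for `b` in the image of `f`, so both actions agree
  -- there and hence on all of `B`.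
  have h : RingCat.ofHom (shearedAction B φ) = RingCat.ofHom (shearedAction B (0 : X →+ Y)) := by
    rw [← cancel_epi (RingCat.ofHom f)]
    refine RingCat.hom_ext (RingHom.ext fun a => AddMonoidHom.ext fun p => ?_)
    change (shearedAction B φ (f a) : AddMonoid.End (X × Y)) p =
      (shearedAction B (0 : X →+ Y) (f a) : AddMonoid.End (X × Y)) p
    simp [shearedAction_apply, hφ]
  have h1 := congrArg (fun r => (RingCat.Hom.hom r b : AddMonoid.End (X × Y)) (x, 0)) h
  change (shearedAction B φ b : AddMonoid.End (X × Y)) (x, 0) =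
    (shearedAction B (0 : X →+ Y) b : AddMonoid.End (X × Y)) (x, 0) at h1
  simpa [shearedAction_apply, sub_eq_zero] using congrArg Prod.snd h1

end Epi

/-! ### Extension of scalars and its adjunction -/

section BaseChange

variable {A : Type u} [Ring A] {C : Type v} [Ring C] (g : A →+* C)

instance rightModuleAlong.instModule : Module C (rightModuleAlong g) :=
  inferInstanceAs (Module C C)

instance rightModuleAlong.instSMulCommClass : SMulCommClass C Aᵐᵒᵖ (rightModuleAlong g) where
  smul_comm c a d := (mul_assoc c d (g a.unop)).symm

/-- `C ⊗_A M` for a ring homomorphism `g : A → C`. -/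
abbrev BaseChange (M : Type w) [AddCommGroup M] [Module A M] : Type (max v w) :=
  BalancedTensor A (rightModuleAlong g) M

namespace BaseChange

variable {M M' : Type w} [AddCommGroup M] [Module A M] [AddCommGroup M'] [Module A M']

/-- The pure tensor `c ⊗ m`. -/
def tmul (c : C) (m : M) : BaseChange g M :=
  QuotientAddGroup.mk ((show rightModuleAlong g from c) ⊗ₜ[ℤ] m)

lemma tmul_add (c : C) (m n : M) : tmul g c (m + n) = tmul g c m + tmul g c n :=
  congrArg QuotientAddGroup.mk (TensorProduct.tmul_add _ _ _)

lemma add_tmul (c d : C) (m : M) : tmul g (c + d) m = tmul g c m + tmul g d m :=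
  congrArg QuotientAddGroup.mk
    (TensorProduct.add_tmul (R := ℤ) (M := rightModuleAlong g) c d m)

lemma tmul_smul (c : C) (a : A) (m : M) : tmul g c (a • m) = tmul g (c * g a) m := by
  symm
  refine (QuotientAddGroup.eq_iff_sub_mem).2 (AddSubgroup.subset_closure ⟨c, a, m, rfl⟩)

variable {g} in
lemma induction_on {p : BaseChange g M → Prop} (x : BaseChange g M)
    (zero : p 0) (tmul : ∀ c m, p (tmul g c m)) (add : ∀ x y, p x → p y → p (x + y)) : p x := by
  obtain ⟨x, rfl⟩ := QuotientAddGroup.mk_surjective x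
  induction x using TensorProduct.induction_on with
  | zero => exact zero
  | tmul c m => exact tmul c m
  | add x y hx hy => exact add _ _ hx hy

instance instSMul : SMul C (BaseChange g M) where
  smul c := QuotientAddGroup.map _ _
    (DistribSMul.toAddMonoidHom ((rightModuleAlong g) ⊗[ℤ] M) c) (by
      rw [balancedSubgroup, AddSubgroup.closure_le]
      rintro _ ⟨n, a, m, rfl⟩
      refine AddSubgroup.subset_closure ⟨c • n, a, m, ?_⟩
      rw [← smul_comm c (MulOpposite.op a) n]
      exact smul_sub c (_ ⊗ₜ[ℤ] m) (n ⊗ₜ[ℤ] (a • m)))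

instance instModule : Module C (BaseChange g M) :=
  Function.Surjective.module C (QuotientAddGroup.mk' (balancedSubgroup A (rightModuleAlong g) M))
    QuotientAddGroup.mk_surjective (fun _ _ => rfl)

lemma smul_tmul (c d : C) (m : M) : c • tmul g d m = tmul g (c * d) m := rfl

/-- The unit `m ↦ 1 ⊗ m` of the adjunction between extension and restriction of scalars. -/
def unit (M : Type w) [AddCommGroup M] [Module A M] : M →ₛₗ[g] BaseChange g M where
  toFun m := tmul g 1 m
  map_add' := tmul_add g 1
  map_smul' a m := by rw [tmul_smul, smul_tmul, one_mul, mul_one]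

lemma smul_unit (c : C) (m : M) : c • unit g M m = tmul g c m := by
  change c • tmul g 1 m = _
  rw [smul_tmul, mul_one]

variable {Y : Type*} [AddCommGroup Y] [Module C Y]

variable {g} in
lemma hom_ext {φ ψ : BaseChange g M →ₗ[C] Y} (h : ∀ m, φ (unit g M m) = ψ (unit g M m)) :
    φ = ψ := by
  ext x
  induction x using induction_on with
  | zero => simp
  | tmul c m => rw [← smul_unit, map_smul, map_smul, h]
  | add x y hx hy => rw [map_add, map_add, hx, hy]

variable {g}

/-- The biadditive map `(c, m) ↦ c • ψ m`. -/
def smulHom (ψ : M →ₛₗ[g] Y) : rightModuleAlong g →+ M →+ Y :=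
  ((AddMonoidHom.compHom (M := M) (N := Y) (P := Y)).flip ψ.toAddMonoidHom).comp
    (Module.toAddMonoidEnd C Y).toAddMonoidHom

/-- The additive map underlying `BaseChange.lift`. -/
def liftAux (ψ : M →ₛₗ[g] Y) : BaseChange g M →+ Y :=
  QuotientAddGroup.lift _
    (TensorProduct.liftAddHom (smulHom ψ) (fun r n m => by simp)) (by
    rw [balancedSubgroup, AddSubgroup.closure_le]
    rintro _ ⟨n, a, m, rfl⟩
    simp only [SetLike.mem_coe, AddMonoidHom.mem_ker, map_sub, sub_eq_zero]
    change ((show C from n) * g a) • ψ m = (show C from n) • ψ (a • m)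
    rw [map_smulₛₗ, mul_smul])

/-- The `C`-linear map `C ⊗_A M → Y` attached to a `g`-semilinear map `M → Y`. -/
def lift (ψ : M →ₛₗ[g] Y) : BaseChange g M →ₗ[C] Y where
  __ := liftAux ψ
  map_smul' c x := by
    change liftAux ψ (c • x) = c • liftAux ψ x
    induction x using induction_on with
    | zero => simp
    | tmul d m => exact mul_smul c d (ψ m)
    | add x y hx hy => rw [smul_add, map_add, map_add, hx, hy, smul_add]

lemma lift_tmul (ψ : M →ₛₗ[g] Y) (c : C) (m : M) : lift ψ (tmul g c m) = c • ψ m := rfl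

lemma lift_unit (ψ : M →ₛₗ[g] Y) (m : M) : lift ψ (unit g M m) = ψ m :=
  one_smul C (ψ m)

variable (g) in
/-- The `C`-linear map `C ⊗_A φ`. -/
def map (φ : M →ₗ[A] M') : BaseChange g M →ₗ[C] BaseChange g M' where
  __ := BalancedTensor.map (rightModuleAlong g) φ
  map_smul' c x := by
    change BalancedTensor.map (rightModuleAlong g) φ (c • x) =
      c • BalancedTensor.map (rightModuleAlong g) φ x
    induction x using induction_on with
    | zero => simp
    | tmul d m => rfl
    | add x y hx hy => rw [smul_add, map_add, map_add, hx, hy, smul_add]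

lemma map_unit (φ : M →ₗ[A] M') (m : M) : map g φ (unit g M m) = unit g M' (φ m) := rfl

end BaseChange
end BaseChange

/-! ### Splitting the base-changed resolution -/

section Semilinear

variable {A : Type u} [Ring A]

/-- Projective modules lift semilinear maps through linear maps. -/
lemma Module.Projective.exists_semilinear_lift {C : Type v} [Ring C] (g : A →+* C)
    {P : Type*} [AddCommGroup P] [Module A P] [Module.Projective A P]
    {X Y : Type*} [AddCommGroup X] [Module C X] [AddCommGroup Y] [Module C Y]
    (φ : X →ₗ[C] Y) (ψ : P →ₛₗ[g] Y) (h : ∀ p, ∃ x, φ x = ψ p) :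
    ∃ χ : P →ₛₗ[g] X, ∀ p, φ (χ p) = ψ p := by
  let _ : Module A X := Module.compHom X g
  let _ : Module A Y := Module.compHom Y g
  let φ' : X →ₗ[A] Y := { φ.toAddMonoidHom with map_smul' := fun a x => φ.map_smul (g a) x }
  let ψ' : P →ₗ[A] φ'.range :=
    { toFun := fun p => ⟨ψ p, h p⟩
      map_add' := fun p q => Subtype.ext (map_add ψ p q)
      map_smul' := fun a p => Subtype.ext (map_smulₛₗ ψ a p) }
  obtain ⟨χ, hχ⟩ := Module.projective_lifting_property φ'.rangeRestrict ψ'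
    φ'.surjective_rangeRestrict
  exact ⟨{ χ.toAddMonoidHom with map_smul' := fun a p => χ.map_smul a p },
    fun p => congrArg Subtype.val (LinearMap.congr_fun hχ p)⟩

variable {B : Type u} [Ring B] {f : A →+* B}

/-- Along a ring epimorphism, a semilinear map out of `M` that kills the kernel of a surjective
semilinear map `M → X` factors through a linear map. -/
lemma exists_linearMap_factor_of_epi (hf : Epi (RingCat.ofHom f)) {M : Type*} [AddCommGroup M]
    [Module A M] {X Y : Type u} [AddCommGroup X] [Module B X] [AddCommGroup Y] [Module B Y]
    (ε : M →ₛₗ[f] X) (hε : Function.Surjective ε) (ψ : M →ₛₗ[f] Y)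
    (h : ∀ m, ε m = 0 → ψ m = 0) : ∃ θ : X →ₗ[B] Y, ∀ m, θ (ε m) = ψ m := by
  let θ : X →+ Y := AddMonoidHom.liftOfSurjective ε.toAddMonoidHom hε
    ⟨ψ.toAddMonoidHom, fun m hm => h m hm⟩
  have hθ : ∀ m, θ (ε m) = ψ m := fun m =>
    AddMonoidHom.liftOfRightInverse_comp_apply ε.toAddMonoidHom _ _
      ⟨ψ.toAddMonoidHom, fun m hm => h m hm⟩ m
  refine ⟨{ θ with map_smul' := map_smul_of_epi f hf θ fun a x => ?_ }, hθ⟩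
  obtain ⟨m, rfl⟩ := hε x
  rw [← map_smulₛₗ, hθ, hθ, map_smulₛₗ]

open BaseChange in
/-- Let `⋯ → P 1 → P 0 → X → 0` be exact, where the `P n` are projective over `A` and `X` is a
projective `B`-module, with `f : A → B` a ring epimorphism. If `B ⊗_A P` is exact in positive
degrees, then `Hom_A (P, Y)` is exact in positive degrees for all `B`-modules `Y`. -/
theorem exists_extension_of_exact_baseChange (hf : Epi (RingCat.ofHom f))
    (P : ℕ → Type u) [∀ n, AddCommGroup (P n)] [∀ n, Module A (P n)]
    [∀ n, Module.Projective A (P n)] (d : ∀ n, P (n + 1) →ₗ[A] P n)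
    {X : Type u} [AddCommGroup X] [Module B X] [Module.Projective B X] (ε : P 0 →ₛₗ[f] X)
    (hε : Function.Surjective ε) (hεd : ∀ x, ε x = 0 ↔ ∃ y, d 0 y = x)
    (hd : ∀ n, Function.Exact (map f (d (n + 1))) (map f (d n)))
    {Y : Type u} [AddCommGroup Y] [Module B Y] (n : ℕ) (φ : P (n + 1) →ₛₗ[f] Y)
    (hφ : ∀ x, φ (d (n + 1) x) = 0) : ∃ ψ : P n →ₛₗ[f] Y, ∀ x, ψ (d n x) = φ x := by
  -- Projectivity of `B ⊗_A P n` over `B`, inherited from `P n` through the adjunction.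
  have lift_mem : ∀ {n : ℕ} {M : Type u} [AddCommGroup M] [Module B M]
      (α : M →ₗ[B] BaseChange f (P n)) (β : BaseChange f (P n) →ₗ[B] BaseChange f (P n)),
      (∀ x, ∃ y, α y = β x) → ∃ s : BaseChange f (P n) →ₗ[B] M, ∀ x, α (s x) = β x := by
    intro n M _ _ α β h
    obtain ⟨χ, hχ⟩ := Module.Projective.exists_semilinear_lift f α (β.comp (unit f (P n)))
      (fun p => h _)
    refine ⟨lift χ, fun x => ?_⟩
    refine LinearMap.congr_fun (f := α ∘ₗ lift χ) (g := β) (hom_ext fun m => ?_) x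
    simpa [lift_unit] using hχ m
  -- The identity `d t d = d` makes `d t` a projection onto the image of `d`, which is thus a direct
  -- summand.
  have homotopy : ∀ n, ∃ t : BaseChange f (P n) →ₗ[B] BaseChange f (P (n + 1)),
      ∀ x, map f (d n) (t (map f (d n) x)) = map f (d n) x := by
    intro n
    induction n with
    | zero =>
      -- The map from `P 0` to the cokernel of `B ⊗ d 0` kills `ker ε`, so by fullness it factors
      -- `B`-linearly through `X`.
      have ker_le : ∀ x, lift ε x = 0 → ∃ y, map f (d 0) y = x := by
        obtain ⟨θ, hθ⟩ := exists_linearMap_factor_of_epi hf ε hε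
          ((LinearMap.range (map f (d 0))).mkQ.comp (unit f (P 0))) (by
            intro m hm
            obtain ⟨y, rfl⟩ := (hεd m).1 hm
            exact (Submodule.Quotient.mk_eq_zero _).2 ⟨unit f _ y, map_unit _ _⟩)
        have : θ ∘ₗ lift ε = (LinearMap.range (map f (d 0))).mkQ :=
          hom_ext fun m => by simpa [lift_unit] using hθ m
        intro x hx
        refine (Submodule.Quotient.mk_eq_zero (LinearMap.range (map f (d 0)))).1 ?_
        simpa [hx] using (LinearMap.congr_fun this x).symm
      obtain ⟨σ, hσ⟩ := Module.projective_lifting_property (lift ε) (LinearMap.id (M := X)) (by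
        intro x
        obtain ⟨m, rfl⟩ := hε x
        exact ⟨unit f _ m, lift_unit ε m⟩)
      -- With `σ` a section of `lift ε`, the map `1 - σ ε` lands in `ker ε = im d`; composing with
      -- `d` kills the `σ ε` term.
      obtain ⟨s, hs⟩ := lift_mem (map f (d 0)) (LinearMap.id - σ ∘ₗ lift ε) (fun x =>
        ker_le _ (by simpa [sub_eq_zero] using (LinearMap.congr_fun hσ (lift ε x)).symm))
      refine ⟨s, fun x => ?_⟩
      have h0 : lift ε ∘ₗ map f (d 0) = 0 := hom_ext fun m => by
        simpa [map_unit, lift_unit] using (hεd _).2 ⟨m, rfl⟩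
      simpa [show lift ε (map f (d 0) x) = 0 from LinearMap.congr_fun h0 x] using
        hs (map f (d 0) x)
    | succ n ih =>
      obtain ⟨t, ht⟩ := ih
      -- Since `d t d = d`, the map `1 - t d` lands in the kernel of `d n`, which is the image of `d
      -- (n + 1)`.
      obtain ⟨s, hs⟩ := lift_mem (map f (d (n + 1))) (LinearMap.id - t ∘ₗ map f (d n))
        (fun x => (hd n _).1 (by simp [ht]))
      exact ⟨s, fun x => by simp [hs, (hd n).apply_apply_eq_zero]⟩
  obtain ⟨t, ht⟩ := homotopy n
  refine ⟨((lift φ).comp t).comp (unit f (P n)), fun x => ?_⟩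
  have h0 : lift φ ∘ₗ map f (d (n + 1)) = 0 := hom_ext fun m => by
    simpa [map_unit, lift_unit] using hφ m
  -- The defect `u - t d u` is a cycle, hence a boundary, and `lift φ` kills boundaries.
  obtain ⟨y, hy⟩ := (hd n (unit f _ x - t (map f (d n) (unit f _ x)))).1 (by simp [ht])
  have h1 := LinearMap.congr_fun h0 y
  simp only [LinearMap.comp_apply, hy, map_sub, map_unit, lift_unit, LinearMap.zero_apply,
    sub_eq_zero] at h1
  exact h1.symm

end Semilinear

/-! ### Vanishing of self-extensions, and injectivity -/

section HomologicalEpi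

variable {A B : Type u} [Ring A] [Ring B] {f : A →+* B}

/-- A homological ring epimorphism `A → B` has `Ext_A^i(B, B) = 0` for all `i > 0`. -/
theorem IsHomologicalRingEpi.subsingleton_ext (hf : IsHomologicalRingEpi f) (i : ℕ) (hi : 0 < i) :
    Subsingleton (Abelian.Ext (leftModuleAlong f) (leftModuleAlong f) i) := by
  obtain ⟨n, rfl⟩ : ∃ n, i = n + 1 := ⟨i - 1, by omega⟩
  let R : ProjectiveResolution (leftModuleAlong f) := projectiveResolution _
  have hproj : ∀ n, Module.Projective A (R.complex.X n) := fun n =>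
    (IsProjective.iff_projective (R := A) (R.complex.X n)).2 (R.projective n)
  let ε : R.complex.X 0 →ₛₗ[f] B :=
    { toFun := fun x => (R.π.f 0).hom x
      map_add' := map_add (R.π.f 0).hom
      map_smul' := fun a x => (R.π.f 0).hom.map_smul a x }
  have hε : Function.Surjective ε := (ModuleCat.epi_iff_surjective (R.π.f 0)).1 inferInstance
  have hεd : ∀ x, ε x = 0 ↔ ∃ y, (R.complex.d 1 0).hom y = x := by
    have h := ShortComplex.exact_of_g_is_cokernel
      (.mk (R.complex.d 1 0) (R.π.f 0) R.complex_d_comp_π_f_zero) R.isColimitCokernelCofork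
    rw [ShortComplex.moduleCat_exact_iff_range_eq_ker] at h
    exact fun x => (SetLike.ext_iff.1 h x).symm
  have hd : ∀ n, Function.Exact (BaseChange.map f (R.complex.d (n + 2) (n + 1)).hom)
      (BaseChange.map f (R.complex.d (n + 1) n).hom) := by
    intro n
    have h0 := (hf.tor_eq_zero (n + 1) n.succ_pos).of_iso (R.isoLeftDerivedObj _ _).symm
    have h1 := (HomologicalComplex.exactAt_iff_isZero_homology _ _).2 h0
    have h2 := (HomologicalComplex.exactAt_iff' _ (n + 2) (n + 1) n (by simp) (by simp)).1 h1
    rw [ShortComplex.ab_exact_iff_function_exact] at h2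
    exact h2
  refine subsingleton_of_forall_eq 0 fun α => ?_
  -- A class of degree `n + 1` is a cocycle on `P (n + 1)`; it is zero once the cocycle extends
  -- along `d` to `P n`.
  obtain ⟨φ, hφ, rfl⟩ := R.extMk_surjective α (n + 2) rfl
  rw [R.extMk_eq_zero_iff _ _ _ _ n rfl]
  obtain ⟨ψ, hψ⟩ := exists_extension_of_exact_baseChange hf.epi (fun n => R.complex.X n)
    (fun n => (R.complex.d (n + 1) n).hom) ε hε hεd hd n (Y := B)
    { toFun := fun x => φ.hom x
      map_add' := map_add φ.hom
      map_smul' := fun a x => φ.hom.map_smul a x }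
    (fun x => congrArg (fun r => r.hom x) hφ)
  refine ⟨ModuleCat.ofHom (Y := leftModuleAlong f)
    { toFun := fun x => ψ x
      map_add' := map_add ψ
      map_smul' := map_smulₛₗ ψ }, ?_⟩
  ext x
  exact hψ x

/-- A self-injective ring has the property that its finitely generated projective modules are
injective. -/
lemma Module.Injective.of_finite_of_projective (hA : IsSelfInjectiveRing A) (P : Type u)
    [AddCommGroup P] [Module A P] [Module.Finite A P] [Module.Projective A P] :
    Module.Injective A P := by
  obtain ⟨n, p, hp⟩ := Module.Finite.exists_fin' A P
  obtain ⟨s, hs⟩ := Module.projective_lifting_property p (LinearMap.id (M := P)) hp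
  have : Module.Injective A A := hA
  refine ⟨fun X Y _ _ _ _ i hi g => ?_⟩
  -- `P` is a retract of the injective module `Aⁿ`: extend there, then project back.
  obtain ⟨h, hh⟩ := Module.Injective.out i hi (s ∘ₗ g)
  exact ⟨p ∘ₗ h, fun x => by simpa [hh] using LinearMap.congr_fun hs (g x)⟩

/-- If `f : A → B` is a ring epimorphism and `B` is injective as an `A`-module, then `B` is
self-injective. -/
lemma isSelfInjectiveRing_of_epi (hf : Epi (RingCat.ofHom f))
    (hB : Module.Injective A (leftModuleAlong f)) : IsSelfInjectiveRing B := by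
  refine ⟨fun X Y _ _ _ _ i hi g => ?_⟩
  let _ : Module A X := Module.compHom X f
  let _ : Module A Y := Module.compHom Y f
  obtain ⟨h, hh⟩ := hB.out (X := X) (Y := Y)
    { i.toAddMonoidHom with map_smul' := fun a x => i.map_smul (f a) x } hi
    { g.toAddMonoidHom with map_smul' := fun a x => g.map_smul (f a) x }
  -- The `A`-linear extension is automatically `B`-linear.
  exact ⟨{ h.toAddMonoidHom with
    map_smul' := map_smul_of_epi (Y := B) f hf h.toAddMonoidHom fun a x => h.map_smul a x }, hh⟩

end HomologicalEpi

/-! ### Universal localisation at the single map `f` -/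

section UniversalLocalisation

variable {A B : Type u} [Ring A] [Ring B] (f : A →+* B)

/-- The map `f : A → B`, as a morphism of left `A`-modules. -/
def leftModuleAlong.structureMap : ModuleCat.of A A ⟶ leftModuleAlong f :=
  ModuleCat.ofHom (Y := leftModuleAlong f)
    { toFun := f
      map_add' := map_add f
      map_smul' := map_mul f }

open BaseChange

variable {C : Type v} [Ring C] (g : A →+* C)

/-- The additive map `B → C ⊗_A B`, `b ↦ 1 ⊗ b`. -/
def oneTmul : B →+ BaseChange g (leftModuleAlong f) :=
  (unit g (leftModuleAlong f)).toAddMonoidHom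

lemma smul_oneTmul (c : C) (b : B) :
    c • oneTmul f g b = tmul g c (M := leftModuleAlong f) b :=
  smul_unit g c (M := leftModuleAlong f) b

lemma oneTmul_map_mul (a : A) (b : B) : oneTmul f g (f a * b) = g a • oneTmul f g b :=
  map_smulₛₗ (unit g (leftModuleAlong f)) a b

/-- The left `C`-linear map `C → C ⊗_A B`, `c ↦ c ⊗ 1`. -/
def tmulOne : C →ₗ[C] BaseChange g (leftModuleAlong f) :=
  LinearMap.toSpanSingleton C _ (oneTmul f g 1)

lemma tmulOne_apply (c : C) : tmulOne f g c = c • oneTmul f g 1 := rfl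

lemma tmulOne_one : tmulOne f g 1 = oneTmul f g 1 := one_smul C _

lemma tmulOne_map (a : A) : tmulOne f g (g a) = oneTmul f g (f a) := by
  rw [tmulOne_apply, ← oneTmul_map_mul, mul_one]

/-- The semilinear map `g : A → C`. -/
def RingHom.toSemilinearMapSelf : A →ₛₗ[g] C where
  toFun := g
  map_add' := map_add g
  map_smul' := map_mul g

/-- Under `C ⊗_A A ≅ C`, the map `C ⊗_A f` becomes `c ↦ c ⊗ 1`. -/
lemma invertsMap_structureMap_iff :
    InvertsMap g (Arrow.mk (leftModuleAlong.structureMap f)) ↔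
      Function.Bijective (tmulOne f g) := by
  have hbij : Function.Bijective (lift (RingHom.toSemilinearMapSelf g)) := by
    refine Function.bijective_iff_has_inverse.2
      ⟨fun c => c • unit g A 1, fun x => ?_, fun c => ?_⟩
    · change lift (RingHom.toSemilinearMapSelf g) x • unit g A 1 = x
      induction x using induction_on with
      | zero => simp
      | tmul c a =>
        rw [lift_tmul, smul_assoc, ← smul_unit]
        refine congrArg (c • ·) ?_
        change g a • unit g A 1 = unit g A a
        rw [← map_smulₛₗ, smul_eq_mul, mul_one]
      | add x y hx hy => rw [map_add, add_smul, hx, hy]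
    · rw [map_smul, lift_unit]
      change c * g 1 = c
      rw [map_one, mul_one]
  have hcomp : tmulOne f g ∘ₗ lift (RingHom.toSemilinearMapSelf g) =
      BaseChange.map g (leftModuleAlong.structureMap f).hom := by
    refine hom_ext fun a => ?_
    rw [LinearMap.comp_apply, lift_unit, map_unit]
    exact tmulOne_map f g a
  change Function.Bijective (BaseChange.map g (leftModuleAlong.structureMap f).hom) ↔ _
  rw [← hcomp, LinearMap.coe_comp]
  exact Function.Bijective.of_comp_iff _ hbij

-- The `A`-linear map `b ↦ 1 ⊗ b` is `B`-linear by fullness, so it is determined by its value at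
-- `1`.
variable {f} in
lemma tmulOne_eq_oneTmul_of_epi (hf : Epi (RingCat.ofHom f)) (b : B) :
    tmulOne f f b = oneTmul f f b := by
  have := map_smul_of_epi f hf (oneTmul f f) (oneTmul_map_mul f f) b 1
  rwa [smul_eq_mul, mul_one, eq_comm] at this

/-- If a map `h : B → C` with `h ∘ f = g` exists, this is the map `C ⊗_A B → C`,
`c ⊗ b ↦ c * h b`. -/
def contract {f : A →+* B} {g : A →+* C} (h : B →+* C) (hh : h.comp f = g) :
    BaseChange g (leftModuleAlong f) →ₗ[C] C :=
  lift (M := leftModuleAlong f)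
    { toFun := h
      map_add' := map_add h
      map_smul' := fun a b => (map_mul h (f a) b).trans
        (congrArg (· * h b) (RingHom.congr_fun hh a)) }

lemma contract_oneTmul {f : A →+* B} {g : A →+* C} (h : B →+* C) (hh : h.comp f = g) (b : B) :
    contract h hh (oneTmul f g b) = h b := one_mul (h b)

lemma contract_tmulOne {f : A →+* B} {g : A →+* C} (h : B →+* C) (hh : h.comp f = g) (c : C) :
    contract h hh (tmulOne f g c) = c := by
  rw [tmulOne_apply, map_smul, contract_oneTmul, map_one, smul_eq_mul, mul_one]

/-- Right multiplication by `b : B` on `C ⊗_A B`. -/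
def mulRight (b : B) : BaseChange g (leftModuleAlong f) →ₗ[C] BaseChange g (leftModuleAlong f) :=
  BaseChange.map g (M := leftModuleAlong f) (M' := leftModuleAlong f)
    { toFun := fun x : B => (x * b : B)
      map_add' := fun x y : B => add_mul x y b
      map_smul' := fun a (x : B) => mul_assoc (f a) x b }

lemma mulRight_oneTmul (b x : B) : mulRight f g b (oneTmul f g x) = oneTmul f g (x * b) := rfl

variable {f g}

/-- If `c ↦ c ⊗ 1` is a bijection from `C` to `C ⊗_A B`, then `A → C` factors uniquely through
`A → B`. -/
lemma existsUnique_factor_of_bijective (hbij : Function.Bijective (tmulOne f g)) :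
    ∃! h : B →+* C, h.comp f = g := by
  -- The factorisation is forced by `h b ⊗ 1 = 1 ⊗ b`.
  choose h hh using fun b : B => hbij.2 (oneTmul f g b)
  refine ⟨RingHom.mk' ⟨⟨h, hbij.1 ((hh 1).trans (tmulOne_one f g).symm)⟩, fun x y => hbij.1 ?_⟩
    (fun x y => hbij.1 ?_), RingHom.ext fun a => hbij.1 ((hh (f a)).trans (tmulOne_map f g a).symm),
    fun k hk => RingHom.ext fun b => hbij.1 ((?_ : tmulOne f g (k b) = _).trans (hh b).symm)⟩
  -- Right multiplication by `y` is `C`-linear and sends `1 ⊗ x = h x • (1 ⊗ 1)` to `h x • (1 ⊗ y)`.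
  · change tmulOne f g (h (x * y)) = tmulOne f g (h x • h y)
    rw [map_smul, hh, hh, ← mulRight_oneTmul, ← hh x, tmulOne_apply, map_smul, mulRight_oneTmul,
      one_mul]
  · change tmulOne f g (h (x + y)) = tmulOne f g (h x + h y)
    rw [map_add, hh, hh, hh, map_add]
  -- Contraction along `k` inverts `c ↦ c ⊗ 1`, and sends both `k b ⊗ 1` and `1 ⊗ b` to `k b`.
  · have hinj : Function.Injective (contract k hk) := by
      intro x y hxy
      obtain ⟨x, rfl⟩ := hbij.2 x
      obtain ⟨y, rfl⟩ := hbij.2 y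
      rw [contract_tmulOne, contract_tmulOne] at hxy
      rw [hxy]
    exact hinj ((contract_tmulOne k hk _).trans (contract_oneTmul k hk b).symm)

/-- A ring epimorphism `f : A → B` such that `B` is finitely generated projective as a left
`A`-module is the universal localisation at the map of projective modules `f : A → B`. -/
theorem isUniversalLocalisation_of_epi (hf : Epi (RingCat.ofHom f))
    (hfin : Module.Finite A (leftModuleAlong f))
    (hproj : Module.Projective A (leftModuleAlong f)) : IsUniversalLocalisation.{u, v} f := by
  refine ⟨PUnit, fun _ => Arrow.mk (leftModuleAlong.structureMap f), fun _ =>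
    ⟨inferInstanceAs (Module.Finite A A), inferInstanceAs (Module.Projective A A), hfin, hproj⟩,
    fun _ => ?_, fun C _ g hg =>
      existsUnique_factor_of_bijective ((invertsMap_structureMap_iff f g).1 (hg PUnit.unit))⟩
  rw [invertsMap_structureMap_iff]
  refine ⟨(Function.LeftInverse.injective
    (contract_tmulOne (RingHom.id B) (RingHom.id_comp f))), fun x => ?_⟩
  induction x using induction_on with
  | zero => exact ⟨0, map_zero _⟩
  | tmul c b =>
    -- In `B ⊗_A B`, `c ⊗ b = c (1 ⊗ b) = c (b ⊗ 1) = cb ⊗ 1`.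
    exact ⟨c • (show B from b), by rw [map_smul, tmulOne_eq_oneTmul_of_epi hf, smul_oneTmul]⟩
  | add x y hx hy =>
    obtain ⟨x, rfl⟩ := hx
    obtain ⟨y, rfl⟩ := hy
    exact ⟨x + y, map_add _ x y⟩

end UniversalLocalisation

lemma IsFiniteDimensionalHom.finite {𝕜 : Type w} [Field 𝕜] {A : Type u} [Ring A] [Algebra 𝕜 A]
    {B : Type v} [Ring B] {f : A →+* B} (h : IsFiniteDimensionalHom 𝕜 f) :
    Module.Finite A (leftModuleAlong f) := by
  obtain ⟨s, hs⟩ := h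
  refine ⟨s, (Submodule.eq_top_iff' (M := leftModuleAlong f)).2 fun x => ?_⟩
  have hx : x ∈ Submodule.span 𝕜 (s : Set
    ((ModuleCat.restrictScalars (algebraMap 𝕜 A)).obj (leftModuleAlong f))) := hs ▸ trivial
  induction hx using Submodule.span_induction with
  | mem x hx => exact Submodule.subset_span hx
  | zero => exact zero_mem _
  | add x y _ _ hx hy => exact add_mem hx hy
  | smul c x _ hx => exact Submodule.smul_mem _ (algebraMap 𝕜 A c) hx

end

theorem corollary3p7 (𝕜 : Type w) [Field 𝕜] [IsAlgClosed 𝕜]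
    (A : Type u) [Ring A] [Algebra 𝕜 A] [Module.Finite 𝕜 A]
    (hA : IsSelfInjectiveRing A) (hT : SatisfiesTachikawa A)
    (B : Type u) [Ring B] (f : A →+* B)
    (hfin : IsFiniteDimensionalHom 𝕜 f) (hf : IsHomologicalRingEpi f) :
    IsUniversalLocalisation.{u, v} f ∧
      Module.Projective A (leftModuleAlong f) ∧
      IsSelfInjectiveRing B := by
  have hfinite : Module.Finite A (leftModuleAlong f) := hfin.finite
  have hproj : Module.Projective A (leftModuleAlong f) := hT _ hfinite hf.subsingleton_ext
  exact ⟨isUniversalLocalisation_of_epi hf.epi hfinite hproj, hproj,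
    isSelfInjectiveRing_of_epi hf.epi (.of_finite_of_projective hA _)⟩
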